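/- Let $Z_1,Z_2,Z_3\in\mathbb R^2$ be pairwise distinct points (the sensors) and let $d_1,d_2,d_3\ge 0$ be real numbers (the measured distances). Let $$O(W)=\sum_{j=1}^3\bigl|\,\|W-Z_j\|^2-d_j^2\,\bigr|\qquad (W\in\mathbb R^2),$$ where $\|\cdot\|$ is the Euclidean norm, let $X\subset\mathbb R^2$ be the set of all global minimizers of $O$ over $\mathbb R^2$, and let $|X|$ be the number of its elements. Write $\|Z_iZ_j\|=\|Z_i-Z_j\|$. Then $|X|=5$ if and only if, after a suitable simultaneous reordering of the pairs $(Z_1,d_1),(Z_2,d_2),(Z_3,d_3)$, all of the following hold: $$\|Z_1Z_3\|=\|Z_2Z_3\|,\qquad \|Z_1Z_3\|>\|Z_1Z_2\|,$$ $$d_1^2=\frac{\|Z_1Z_2\|^2}{4}+\left(\|Z_1Z_3\|^2-\frac{\|Z_1Z_2\|^2}{4}\right)\left(\frac{\|Z_1Z_3\|^2+\|Z_1Z_2\|^2}{\|Z_1Z_3\|^2-\|Z_1Z_2\|^2}\right)^2,$$ $$d_3=\sqrt{d_1^2-\|Z_1Z_3\|^2},\qquad d_2=d_1.$$ -/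

import Mathlib

/-- The objective function `O(W) = ∑ⱼ | ‖W - Zⱼ‖² - dⱼ² |` of the planar source localization
problem with sensors `Z` and measured distances `d`. -/
noncomputable def gpsObjective (Z : Fin 3 → EuclideanSpace ℝ (Fin 2)) (d : Fin 3 → ℝ)
    (W : EuclideanSpace ℝ (Fin 2)) : ℝ :=
  ∑ j, |‖W - Z j‖ ^ 2 - d j ^ 2|

/-- The solution set `X = argmin O`: all global minimizers of the objective over the plane. -/
def gpsSolutions (Z : Fin 3 → EuclideanSpace ℝ (Fin 2)) (d : Fin 3 → ℝ) :
    Set (EuclideanSpace ℝ (Fin 2)) :=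
  {W | ∀ V, gpsObjective Z d W ≤ gpsObjective Z d V}

/-- The conditions for five solutions, for sensors `A`, `B`, `C` (in this order) and corresponding
measured distances `a`, `b`, `c`. -/
def FiveSolutionConditions (A B C : EuclideanSpace ℝ (Fin 2)) (a b c : ℝ) : Prop :=
  dist A C = dist B C ∧
  dist A B < dist A C ∧
  a ^ 2 = dist A B ^ 2 / 4 + (dist A C ^ 2 - dist A B ^ 2 / 4) *
    ((dist A C ^ 2 + dist A B ^ 2) / (dist A C ^ 2 - dist A B ^ 2)) ^ 2 ∧
  c = Real.sqrt (a ^ 2 - dist A C ^ 2) ∧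
  b = a

/-! Call `‖W - Zⱼ‖² - dⱼ²` the power of `W` with respect to circle `j`. All three powers have the
same quadratic part, so differences of powers are affine in `W`.

Necessity. Multipliers `tⱼ ∈ [-1, 1]` with `tⱼ fⱼ(W) = |fⱼ(W)|` and `∑ tⱼ (W - Zⱼ) = 0` bound `O(V)`
below by `O(W) + (∑ tⱼ) ‖V - W‖²`. A minimizer off two circles has such multipliers with positive
sum, so it is unique (`gpsSolutions_eq_singleton_of_ne`). Five minimizers therefore all lie on at
least two circles, and not on all three, since the minimum is positive. Two circles share at most
two points, so the three pairs contribute at least 2, 2 and 1. In `conditions_of_five_points` the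
two full pairs turn out to be symmetric about the common center; this makes the triangle isosceles,
and the fifth point, together with minimality, fixes the radii.

Sufficiency. Linear coordinates `(P, R)` along the axis and the base of the isosceles triangle turn
`O` into a positive multiple of a one-parameter sum of three absolute values. By `abs_sum_canonical`
its minimum 1 is attained exactly at the rectangle `(±1, ±1)` and the point `(-2, 0)`. -/

/-! ### The canonical three-term minimization problem -/

/-- The sum is at least the spread of `0`, `(P + R) / 2`, `(P - R) / 2`, which bounds the region.
Choosing a sign for each absolute value by the order of these three numbers gives a second bound, `R
- F ≤ 1` or `P - F ≤ 1`; on the bounded region it can only hold with equality, at the listed points.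
-/
theorem abs_sum_canonical_aux {l P R : ℝ} (hl : 0 < l) (hR : 0 ≤ R)
    (h : |l * P ^ 2 + (1 + 3 * l) * R ^ 2 - (1 + 4 * l)| +
      |l * P ^ 2 + (1 + 3 * l) * R ^ 2 - (1 + 4 * l) - (P + R) / 2| +
      |l * P ^ 2 + (1 + 3 * l) * R ^ 2 - (1 + 4 * l) - (P - R) / 2| ≤ 1) :
    R = 1 ∧ (P = 1 ∨ P = -1) ∨ R = 0 ∧ P = -2 := by
  set F := l * P ^ 2 + (1 + 3 * l) * R ^ 2 - (1 + 4 * l) with hF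
  have a1 := le_abs_self F
  have a2 := neg_abs_le F
  have b1 := le_abs_self (F - (P + R) / 2)
  have b2 := neg_abs_le (F - (P + R) / 2)
  have c1 := le_abs_self (F - (P - R) / 2)
  have c2 := neg_abs_le (F - (P - R) / 2)
  rcases le_total P R with h1 | h1
  · rcases le_total (-R) P with h2 | h2
    · -- `|P| ≤ R`
      have hR1 : R ≤ 1 := by linarith [abs_nonneg F]
      have hPR : P ^ 2 ≤ R ^ 2 := by nlinarith
      have hFle : F ≤ (1 + 4 * l) * (R ^ 2 - 1) := by nlinarith
      -- Combines `hFle` with `R - F ≤ 1`.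
      have key : (1 - R) * ((1 + 4 * l) * (1 + R) - 1) ≤ 0 := by nlinarith
      have hR1' : R = 1 := by
        by_contra hne
        have : R < 1 := lt_of_le_of_ne hR1 hne
        have : 0 < (1 + 4 * l) * (1 + R) - 1 := by nlinarith [mul_nonneg hl.le hR]
        nlinarith
      have hF0 : F = 0 := by subst hR1'; linarith
      left
      refine ⟨hR1', ?_⟩
      rw [hR1'] at hF
      have : l * ((P - 1) * (P + 1)) = 0 := by linarith
      rcases mul_eq_zero.1 this with h | h
      · exact absurd h hl.ne'
      · rcases mul_eq_zero.1 h with h | h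
        · left; linarith
        · right; linarith
    · -- `P ≤ -R`
      have hy : (R - P) / 2 ≤ 1 := by linarith [abs_nonneg (F - (P + R) / 2)]
      have hRF : R - F ≤ 1 := by linarith
      obtain ⟨s, hs⟩ : ∃ s, s = P + 2 - R := ⟨_, rfl⟩
      have hs0 : 0 ≤ s := by linarith
      have hP : P = s + R - 2 := by linarith
      have hs2 : s ≤ 2 - 2 * R := by linarith
      -- `R - F - 1` is nonnegative on the triangle `0 ≤ R`, `0 ≤ s ≤ 2 - 2 R`
      have hid : R - F - 1 = (1 + 4 * l) * (R * (1 - R)) + l * (s * (4 - 2 * R - s)) := by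
        rw [hF, hP]; ring
      have t1 : 0 ≤ R * (1 - R) := by nlinarith
      have t2 : 0 ≤ s * (4 - 2 * R - s) := by nlinarith
      have t1' : R * (1 - R) = 0 := by
        have := mul_nonneg hl.le t1
        have := mul_nonneg hl.le t2
        nlinarith
      have t2' : s = 0 := by
        have : l * (s * (4 - 2 * R - s)) = 0 := by
          have := mul_nonneg hl.le t2
          rw [t1'] at hid
          linarith
        rcases mul_eq_zero.1 this with h | h
        · exact absurd h hl.ne'
        · rcases mul_eq_zero.1 h with h | h
          · exact h
          · linarith
      rcases mul_eq_zero.1 t1' with h | h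
      · right; exact ⟨h, by linarith⟩
      · left; exact ⟨by linarith, Or.inr (by linarith)⟩
  · -- `R ≤ P`
    have hx : (P + R) / 2 ≤ 1 := by linarith [abs_nonneg (F - (P - R) / 2)]
    have hPF : P - F ≤ 1 := by linarith
    have hR1 : R ≤ 1 := by linarith
    have hP2 : P ≤ 2 - R := by linarith
    have hid : P - F - 1 =
        (1 + 4 * l) * (R * (1 - R)) + (P - R) + l * ((2 - R - P) * (2 - R + P)) := by
      rw [hF]; ring
    have hlq := mul_nonneg hl.le (mul_nonneg (sub_nonneg.2 hP2) (by linarith : 0 ≤ 2 - R + P))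
    have hz : (1 + 4 * l) * (R * (1 - R)) + (P - R) ≤ 0 := by linarith
    have t1 : 0 ≤ R * (1 - R) := by nlinarith
    have hPR : P = R := by
      have := mul_nonneg hl.le t1
      linarith
    have t1' : R * (1 - R) = 0 := by
      have := mul_nonneg hl.le t1
      linarith
    rw [hPR] at hid
    rcases mul_eq_zero.1 t1' with h | h
    · rw [hPR, h] at hPF
      rw [h] at hid
      linarith
    · left; exact ⟨by linarith, Or.inl (by linarith)⟩

theorem abs_sum_canonical {l P R : ℝ} (hl : 0 < l)
    (h : |l * P ^ 2 + (1 + 3 * l) * R ^ 2 - (1 + 4 * l)| +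
      |l * P ^ 2 + (1 + 3 * l) * R ^ 2 - (1 + 4 * l) - (P + R) / 2| +
      |l * P ^ 2 + (1 + 3 * l) * R ^ 2 - (1 + 4 * l) - (P - R) / 2| ≤ 1) :
    (P, R) ∈ ({(1, 1), (1, -1), (-1, 1), (-1, -1), (-2, 0)} : Finset (ℝ × ℝ)) := by
  simp only [Finset.mem_insert, Finset.mem_singleton, Prod.mk.injEq]
  rcases le_total 0 R with hR | hR
  · have := abs_sum_canonical_aux hl hR h
    tauto
  -- The reflection `R ↦ -R` exchanges the last two terms.
  · have := abs_sum_canonical_aux (P := P) hl (neg_nonneg.2 hR) (by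
      rw [neg_sq, ← sub_eq_add_neg, sub_neg_eq_add]; linarith)
    rw [neg_eq_zero, neg_eq_iff_eq_neg] at this
    tauto

theorem abs_sum_canonical_eq_one {l : ℝ} {x : ℝ × ℝ}
    (hx : x ∈ ({(1, 1), (1, -1), (-1, 1), (-1, -1), (-2, 0)} : Finset (ℝ × ℝ))) :
    |l * x.1 ^ 2 + (1 + 3 * l) * x.2 ^ 2 - (1 + 4 * l)| +
      |l * x.1 ^ 2 + (1 + 3 * l) * x.2 ^ 2 - (1 + 4 * l) - (x.1 + x.2) / 2| +
      |l * x.1 ^ 2 + (1 + 3 * l) * x.2 ^ 2 - (1 + 4 * l) - (x.1 - x.2) / 2| = 1 := by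
  simp only [Finset.mem_insert, Finset.mem_singleton] at hx
  have e : l + (1 + 3 * l) - (1 + 4 * l) = 0 := by ring
  have e' : l * 4 - (1 + 4 * l) = -1 := by ring
  rcases hx with rfl | rfl | rfl | rfl | rfl <;> norm_num [e, e']

/-! ### Plane algebra behind the necessity of the conditions -/

theorem eq_zero_of_dot_eq_zero {x y p₁ q₁ p₂ q₂ : ℝ} (hX : p₁ * q₂ - p₂ * q₁ ≠ 0)
    (h₁ : x * p₁ + y * q₁ = 0) (h₂ : x * p₂ + y * q₂ = 0) : x = 0 ∧ y = 0 := by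
  constructor
  · refine (mul_eq_zero.1 (?_ : x * (p₁ * q₂ - p₂ * q₁) = 0)).resolve_right hX
    linear_combination q₂ * h₁ - q₁ * h₂
  · refine (mul_eq_zero.1 (?_ : y * (p₁ * q₂ - p₂ * q₁) = 0)).resolve_right hX
    linear_combination p₁ * h₂ - p₂ * h₁

theorem exists_eq_linear_combination {p₁ q₁ p₂ q₂ : ℝ} (hX : p₁ * q₂ - p₂ * q₁ ≠ 0) (w₀ w₁ : ℝ) :
    ∃ x y, x * p₁ + y * q₁ = w₀ ∧ x * p₂ + y * q₂ = w₁ := by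
  refine ⟨(w₀ * q₂ - w₁ * q₁) / (p₁ * q₂ - p₂ * q₁), (p₁ * w₁ - p₂ * w₀) / (p₁ * q₂ - p₂ * q₁),
    ?_, ?_⟩ <;> rw [div_mul_eq_mul_div, div_mul_eq_mul_div, ← add_div, div_eq_iff hX] <;> ring

theorem cross_eq_zero_of_perp {x y p q g h : ℝ} (hne : ¬(x = 0 ∧ y = 0))
    (h₁ : x * p + y * q = 0) (h₂ : g * x + h * y = 0) : g * q - h * p = 0 := by
  by_contra hc
  refine hne ⟨(mul_eq_zero.1 (?_ : x * (g * q - h * p) = 0)).resolve_right hc,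
    (mul_eq_zero.1 (?_ : y * (g * q - h * p) = 0)).resolve_right hc⟩
  · linear_combination q * h₂ - h * h₁
  · linear_combination g * h₁ - p * h₂

/-- In the plane, a vector orthogonal to `(p₁, q₁)` is parallel to its quarter turn, so its product
with `(p₂, q₂)` is governed by the cross product. -/
theorem dot_sq_of_perp {w₀ w₁ p₁ q₁ p₂ q₂ : ℝ} (h : w₀ * p₁ + w₁ * q₁ = 0) :
    (w₀ * p₂ + w₁ * q₂) ^ 2 * (p₁ ^ 2 + q₁ ^ 2) =
      (w₀ ^ 2 + w₁ ^ 2) * (p₁ * q₂ - p₂ * q₁) ^ 2 := by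
  linear_combination (2 * (p₁ * p₂ + q₁ * q₂) * (w₀ * p₂ + w₁ * q₂) -
    (p₂ ^ 2 + q₂ ^ 2) * (w₀ * p₁ + w₁ * q₁)) * h

/-- Three points lying pairwise on two of three circles with collinear centers `0`, `k • (p, q)`,
`(p, q)` cannot have the same power, up to sign, with respect to the remaining circle. -/
theorem collinear_impossible {k p q w₀ w₁ v₀ v₁ u₀ u₁ D₁ D₂ D₃ V : ℝ} (hV : 0 < V)
    (w3 : w₀ ^ 2 + w₁ ^ 2 = D₃) (w1 : (w₀ - k * p) ^ 2 + (w₁ - k * q) ^ 2 = D₁)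
    (w2 : ((w₀ - p) ^ 2 + (w₁ - q) ^ 2 - D₂) ^ 2 = V ^ 2)
    (v3 : v₀ ^ 2 + v₁ ^ 2 = D₃) (v2 : (v₀ - p) ^ 2 + (v₁ - q) ^ 2 = D₂)
    (v1 : ((v₀ - k * p) ^ 2 + (v₁ - k * q) ^ 2 - D₁) ^ 2 = V ^ 2)
    (u1 : (u₀ - k * p) ^ 2 + (u₁ - k * q) ^ 2 = D₁) (u2 : (u₀ - p) ^ 2 + (u₁ - q) ^ 2 = D₂)
    (u3 : (u₀ ^ 2 + u₁ ^ 2 - D₃) ^ 2 = V ^ 2) : False := by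
  have hV2 : 0 < V ^ 2 := by positivity
  -- With collinear centers every difference of powers depends only on the projection to the line,
  -- so two projections determine all three powers.
  obtain ⟨α, hα⟩ : ∃ α, α = p * (w₀ - u₀) + q * (w₁ - u₁) := ⟨_, rfl⟩
  obtain ⟨β, hβ⟩ : ∃ β, β = p * (v₀ - u₀) + q * (v₁ - u₁) := ⟨_, rfl⟩
  have e1 : (w₀ - p) ^ 2 + (w₁ - q) ^ 2 - D₂ = 2 * ((k - 1) * α) := by
    rw [hα]; linear_combination w1 - u1 + u2
  have e2 : u₀ ^ 2 + u₁ ^ 2 - D₃ = -2 * (k * α) := by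
    rw [hα]; linear_combination u1 - w1 + w3
  have e3 : (v₀ - k * p) ^ 2 + (v₁ - k * q) ^ 2 - D₁ = -2 * ((k - 1) * β) := by
    rw [hβ]; linear_combination v2 - u2 + u1
  have e4 : u₀ ^ 2 + u₁ ^ 2 - D₃ = -2 * β := by
    rw [hβ]; linear_combination u2 - v2 + v3
  have f2 := u3
  rw [e1] at w2
  rw [e2] at f2
  rw [e3] at v1
  rw [e4] at u3
  have hα0 : α ^ 2 ≠ 0 := by
    intro h
    have : V ^ 2 = 0 := by linear_combination (4 * k ^ 2) * h - f2
    linarith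
  have hβ0 : β ^ 2 ≠ 0 := by
    intro h
    have : V ^ 2 = 0 := by linear_combination 4 * h - u3
    linarith
  have h1 : (k - 1) ^ 2 = k ^ 2 := mul_right_cancel₀ hα0 (by linear_combination (w2 - f2) / 4)
  have h2 : (k - 1) ^ 2 = 1 := mul_right_cancel₀ hβ0 (by linear_combination (v1 - u3) / 4)
  have : k = 1 / 2 := by linarith
  subst this
  norm_num at h2

/-- Centers `0`, `(p₁, q₁)`, `(p₂, q₂)` and squared radii `D₃`, `D₁`, `D₂`, where both common points
of the circles `1, 3`, both common points of the circles `2, 3` and one common point of the circles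
`1, 2` have power `± V` with respect to the remaining circle, and `V` is least. -/
theorem conditions_of_five_points {p₁ q₁ p₂ q₂ w₀ w₁ w₀' w₁' v₀ v₁ v₀' v₁' u₀ u₁ D₁ D₂ D₃ V : ℝ}
    (hV : 0 < V)
    (hz₂ : ¬(p₂ = 0 ∧ q₂ = 0))
    (hw : ¬(w₀ - w₀' = 0 ∧ w₁ - w₁' = 0)) (hv : ¬(v₀ - v₀' = 0 ∧ v₁ - v₁' = 0))
    (w3 : w₀ ^ 2 + w₁ ^ 2 = D₃) (w1 : (w₀ - p₁) ^ 2 + (w₁ - q₁) ^ 2 = D₁)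
    (w2 : ((w₀ - p₂) ^ 2 + (w₁ - q₂) ^ 2 - D₂) ^ 2 = V ^ 2)
    (w3' : w₀' ^ 2 + w₁' ^ 2 = D₃) (w1' : (w₀' - p₁) ^ 2 + (w₁' - q₁) ^ 2 = D₁)
    (w2' : ((w₀' - p₂) ^ 2 + (w₁' - q₂) ^ 2 - D₂) ^ 2 = V ^ 2)
    (v3 : v₀ ^ 2 + v₁ ^ 2 = D₃) (v2 : (v₀ - p₂) ^ 2 + (v₁ - q₂) ^ 2 = D₂)
    (v1 : ((v₀ - p₁) ^ 2 + (v₁ - q₁) ^ 2 - D₁) ^ 2 = V ^ 2)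
    (v3' : v₀' ^ 2 + v₁' ^ 2 = D₃) (v2' : (v₀' - p₂) ^ 2 + (v₁' - q₂) ^ 2 = D₂)
    (v1' : ((v₀' - p₁) ^ 2 + (v₁' - q₁) ^ 2 - D₁) ^ 2 = V ^ 2)
    (u1 : (u₀ - p₁) ^ 2 + (u₁ - q₁) ^ 2 = D₁) (u2 : (u₀ - p₂) ^ 2 + (u₁ - q₂) ^ 2 = D₂)
    (u3 : (u₀ ^ 2 + u₁ ^ 2 - D₃) ^ 2 = V ^ 2)
    (hmin : ∀ x y : ℝ, (x - p₁) ^ 2 + (y - q₁) ^ 2 = D₁ → (x - p₂) ^ 2 + (y - q₂) ^ 2 = D₂ →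
      V ^ 2 ≤ (x ^ 2 + y ^ 2 - D₃) ^ 2) :
    p₁ ^ 2 + q₁ ^ 2 = p₂ ^ 2 + q₂ ^ 2 ∧
    (p₁ - p₂) ^ 2 + (q₁ - q₂) ^ 2 < p₁ ^ 2 + q₁ ^ 2 ∧
    D₁ = ((p₁ - p₂) ^ 2 + (q₁ - q₂) ^ 2) / 4 +
      (p₁ ^ 2 + q₁ ^ 2 - ((p₁ - p₂) ^ 2 + (q₁ - q₂) ^ 2) / 4) *
      ((p₁ ^ 2 + q₁ ^ 2 + ((p₁ - p₂) ^ 2 + (q₁ - q₂) ^ 2)) /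
        (p₁ ^ 2 + q₁ ^ 2 - ((p₁ - p₂) ^ 2 + (q₁ - q₂) ^ 2))) ^ 2 ∧
    D₃ = D₁ - (p₁ ^ 2 + q₁ ^ 2) ∧ D₂ = D₁ := by
  have hV2 : 0 < V ^ 2 := by positivity
  have hX : p₁ * q₂ - p₂ * q₁ ≠ 0 := by
    intro hX
    obtain ⟨k, hp, hq⟩ : ∃ k, p₁ = k * p₂ ∧ q₁ = k * q₂ := by
      by_cases h : p₂ = 0
      · have hq : q₂ ≠ 0 := fun h' => hz₂ ⟨h, h'⟩
        subst h
        refine ⟨q₁ / q₂, ?_, by field_simp⟩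
        have := (mul_eq_zero.1 (by linarith : p₁ * q₂ = 0)).resolve_right hq
        simp [this]
      · refine ⟨p₁ / p₂, by field_simp, ?_⟩
        field_simp
        linarith
    subst hp hq
    exact collinear_impossible hV w3 w1 w2 v3 v2 v1 u1 u2 u3
  have hX2 : 0 < (p₁ * q₂ - p₂ * q₁) ^ 2 := by positivity
  have w1d : (w₀ - w₀') * p₁ + (w₁ - w₁') * q₁ = 0 := by
    linear_combination (w3 - w3' - w1 + w1') / 2
  have v2d : (v₀ - v₀') * p₂ + (v₁ - v₁') * q₂ = 0 := by
    linear_combination (v3 - v3' - v2 + v2') / 2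
  -- Equal powers would make `w - w'` orthogonal to both centers, hence zero.
  have hw2 : (w₀ - p₂) ^ 2 + (w₁ - q₂) ^ 2 - D₂ = -((w₀' - p₂) ^ 2 + (w₁' - q₂) ^ 2 - D₂) := by
    refine (sq_eq_sq_iff_eq_or_eq_neg.1 (w2.trans w2'.symm)).resolve_left fun h => hw ?_
    exact eq_zero_of_dot_eq_zero hX w1d (by linear_combination (w3 - w3' - h) / 2)
  have hv1 : (v₀ - p₁) ^ 2 + (v₁ - q₁) ^ 2 - D₁ = -((v₀' - p₁) ^ 2 + (v₁' - q₁) ^ 2 - D₁) := by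
    refine (sq_eq_sq_iff_eq_or_eq_neg.1 (v1.trans v1'.symm)).resolve_left fun h => hv ?_
    exact eq_zero_of_dot_eq_zero hX (by linear_combination (v3 - v3' - h) / 2) v2d
  -- For each pair, the powers with respect to each circle sum to zero; subtracting these relations
  -- shows that both pairs have the same midpoint.
  obtain ⟨g0, g1⟩ : w₀ + w₀' - (v₀ + v₀') = 0 ∧ w₁ + w₁' - (v₁ + v₁') = 0 := by
    refine eq_zero_of_dot_eq_zero hX ?_ ?_
    · linear_combination (w3 + w3' - w1 - w1' - (v3 + v3' - hv1)) / 2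
    · linear_combination (w3 + w3' - hw2 - (v3 + v3' - v2 - v2')) / 2
  have gz1 : (w₀ + w₀') * q₁ - (w₁ + w₁') * p₁ = 0 :=
    cross_eq_zero_of_perp hw w1d (by linear_combination w3 - w3')
  have gz2 : (w₀ + w₀') * q₂ - (w₁ + w₁') * p₂ = 0 :=
    cross_eq_zero_of_perp hv v2d (by
      linear_combination v3 - v3' + (v₀ - v₀') * g0 + (v₁ - v₁') * g1)
  -- The common midpoint lies on the lines from the origin through both other centers, so it is the
  -- origin.
  obtain ⟨s0, s1⟩ : w₀ + w₀' = 0 ∧ w₁ + w₁' = 0 := by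
    have := eq_zero_of_dot_eq_zero (x := -(w₁ + w₁')) (y := w₀ + w₀') hX (by linarith)
      (by linarith)
    exact ⟨this.2, by linarith [this.1]⟩
  have hw1 : w₀ * p₁ + w₁ * q₁ = 0 := by
    linear_combination w1d / 2 + (s0 * p₁ + s1 * q₁) / 2
  have hv2 : v₀ * p₂ + v₁ * q₂ = 0 := by
    linear_combination v2d / 2 + ((s0 - g0) * p₂ + (s1 - g1) * q₂) / 2
  have hD1 : D₁ = D₃ + (p₁ ^ 2 + q₁ ^ 2) := by linear_combination w3 - w1 - 2 * hw1
  have hD2 : D₂ = D₃ + (p₂ ^ 2 + q₂ ^ 2) := by linear_combination v3 - v2 - 2 * hv2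
  have hVw : V ^ 2 = 4 * (w₀ * p₂ + w₁ * q₂) ^ 2 := by
    have : (w₀ - p₂) ^ 2 + (w₁ - q₂) ^ 2 - D₂ = -2 * (w₀ * p₂ + w₁ * q₂) := by
      linear_combination w3 - hD2
    rw [← w2, this]; ring
  have hVv : V ^ 2 = 4 * (v₀ * p₁ + v₁ * q₁) ^ 2 := by
    have : (v₀ - p₁) ^ 2 + (v₁ - q₁) ^ 2 - D₁ = -2 * (v₀ * p₁ + v₁ * q₁) := by
      linear_combination v3 - hD1
    rw [← v1, this]; ring
  have hVL : V ^ 2 * (p₁ ^ 2 + q₁ ^ 2) = 4 * D₃ * (p₁ * q₂ - p₂ * q₁) ^ 2 := by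
    rw [hVw, ← w3]
    linear_combination 4 * dot_sq_of_perp (p₂ := p₂) (q₂ := q₂) hw1
  have hVL' : V ^ 2 * (p₂ ^ 2 + q₂ ^ 2) = 4 * D₃ * (p₁ * q₂ - p₂ * q₁) ^ 2 := by
    rw [hVv, ← v3]
    linear_combination 4 * dot_sq_of_perp (p₂ := p₁) (q₂ := q₁) hv2
  have hL : p₁ ^ 2 + q₁ ^ 2 = p₂ ^ 2 + q₂ ^ 2 :=
    mul_left_cancel₀ hV2.ne' (hVL.trans hVL'.symm)
  obtain ⟨T, hT⟩ : ∃ T, T = u₀ * p₁ + u₁ * q₁ := ⟨_, rfl⟩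
  have hT' : T = u₀ * p₂ + u₁ * q₂ := by
    rw [hT]; linear_combination (u2 - u1 - hD1 + hD2) / 2
  have huu : u₀ ^ 2 + u₁ ^ 2 = D₃ + 2 * T := by
    rw [hT]; linear_combination u1 + hD1
  have hVT : V ^ 2 = 4 * T ^ 2 := by rw [← u3, huu]; ring
  have hT0 : T ≠ 0 := by rintro rfl; simp at hVT; exact hV.ne' hVT
  obtain ⟨b, hb⟩ : ∃ b, b = (p₁ - p₂) ^ 2 + (q₁ - q₂) ^ 2 := ⟨_, rfl⟩
  obtain ⟨L, hLdef⟩ : ∃ L, L = p₁ ^ 2 + q₁ ^ 2 := ⟨_, rfl⟩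
  obtain ⟨X, hXdef⟩ : ∃ X, X = (p₁ * q₂ - p₂ * q₁) ^ 2 := ⟨_, rfl⟩
  rw [← hXdef] at hX2 hVL
  have hTb : T ^ 2 * b = (D₃ + 2 * T) * X := by
    have h0 : u₀ * (p₁ - p₂) + u₁ * (q₁ - q₂) = 0 := by linear_combination hT' - hT
    have := dot_sq_of_perp (p₂ := p₂) (q₂ := q₂) h0
    rw [← hT', huu, ← hb] at this
    rw [this, hXdef]; ring
  have hTL : T ^ 2 * L = D₃ * X := by rw [hLdef]; linear_combination (hVL - hVT * (p₁ ^ 2 + q₁ ^ 2)) / 4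
  have hTlin : T * (b - L) = 2 * X := by
    apply mul_left_cancel₀ hT0
    linear_combination hTb - hTL
  have hXb : X = b * (L - b / 4) := by
    rw [hXdef, hb, hLdef]
    linear_combination (-(p₁ ^ 2 + q₁ ^ 2 - (p₂ ^ 2 + q₂ ^ 2)) / 4 -
      ((p₁ - p₂) ^ 2 + (q₁ - q₂) ^ 2) / 2) * hL
  -- Were `T` positive, the second common point of circles 1 and 2 would have smaller power in
  -- absolute value, against `hmin`.
  have hTneg : T < 0 := by
    by_contra hneg
    have hTpos : 0 < T := lt_of_le_of_ne (not_lt.1 hneg) hT0.symm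
    have hD3 : 0 ≤ D₃ := by rw [← w3]; positivity
    have hN : 0 < D₃ + 2 * T := by linarith
    have hNne := hN.ne'
    -- The line through the origin and `u` is the radical axis of circles 1 and 2. The origin has
    -- power `-D₃` there, so the second intersection is `κ u` with `κ ‖u‖² = -D₃`.
    obtain ⟨κ, hκ⟩ : ∃ κ, κ = -(D₃ / (D₃ + 2 * T)) := ⟨_, rfl⟩
    have hκN : κ * (D₃ + 2 * T) = -D₃ := by rw [hκ]; field_simp
    have hroot : κ ^ 2 * (D₃ + 2 * T) - 2 * κ * T = D₃ := by
      linear_combination (κ - 1) * hκN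
    have := hmin (κ * u₀) (κ * u₁)
      (by rw [hD1]; linear_combination κ ^ 2 * huu + hroot + 2 * κ * hT)
      (by rw [hD2]; linear_combination κ ^ 2 * huu + hroot + 2 * κ * hT')
    have e : (κ * u₀) ^ 2 + (κ * u₁) ^ 2 - D₃ = 2 * κ * T := by
      linear_combination κ ^ 2 * huu + hroot
    rw [e, hVT] at this
    have hκ1 : κ ^ 2 < 1 := by
      have h1 : D₃ / (D₃ + 2 * T) < 1 := by rw [div_lt_one hN]; linarith
      have h2 : 0 ≤ D₃ / (D₃ + 2 * T) := by positivity
      rw [hκ, neg_sq]; exact pow_lt_one₀ h2 h1 two_ne_zero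
    linarith [mul_pos (sub_pos.2 hκ1) (sq_pos_of_pos hTpos)]
  have hLb : b < L := by
    by_contra h
    linarith [mul_nonpos_of_nonpos_of_nonneg hTneg.le (sub_nonneg.2 (not_lt.1 h))]
  have hLbne : L - b ≠ 0 := by linarith
  have hD3 : D₃ * (L - b) ^ 2 = 4 * X * L := by
    apply mul_right_cancel₀ hX2.ne'
    linear_combination (-(L - b) ^ 2) * hTL + L * (2 * X + T * (b - L)) * hTlin
  rw [← hLdef, ← hb]
  refine ⟨hLdef.trans hL, hLb, ?_, by rw [hD1, hLdef]; ring, by rw [hD1, hD2, hL]⟩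
  rw [hD1, ← hLdef]
  have : D₃ = 4 * X * L / (L - b) ^ 2 := by field_simp; linarith
  rw [this, hXb]
  field_simp
  ring

/-! ### Circle powers and first-order optimality -/

/-- The power of `W` with respect to the circle with center `P` and radius `r`. -/
noncomputable def circlePower (P : EuclideanSpace ℝ (Fin 2)) (r : ℝ)
    (W : EuclideanSpace ℝ (Fin 2)) : ℝ :=
  ‖W - P‖ ^ 2 - r ^ 2

theorem gpsObjective_eq (Z : Fin 3 → EuclideanSpace ℝ (Fin 2)) (d : Fin 3 → ℝ)
    (W : EuclideanSpace ℝ (Fin 2)) :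
    gpsObjective Z d W = ∑ j, |circlePower (Z j) (d j) W| := rfl

theorem gpsObjective_eq_add (Z : Fin 3 → EuclideanSpace ℝ (Fin 2)) (d : Fin 3 → ℝ)
    (W : EuclideanSpace ℝ (Fin 2)) :
    gpsObjective Z d W = |circlePower (Z 0) (d 0) W| + |circlePower (Z 1) (d 1) W| +
      |circlePower (Z 2) (d 2) W| := by
  rw [gpsObjective_eq, Fin.sum_univ_three]

theorem gpsObjective_comp_perm (Z : Fin 3 → EuclideanSpace ℝ (Fin 2)) (d : Fin 3 → ℝ)
    (σ : Equiv.Perm (Fin 3)) (W : EuclideanSpace ℝ (Fin 2)) :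
    gpsObjective (Z ∘ σ) (d ∘ σ) W = gpsObjective Z d W :=
  Equiv.sum_comp σ fun j => |circlePower (Z j) (d j) W|

theorem gpsSolutions_comp_perm (Z : Fin 3 → EuclideanSpace ℝ (Fin 2)) (d : Fin 3 → ℝ)
    (σ : Equiv.Perm (Fin 3)) : gpsSolutions (Z ∘ σ) (d ∘ σ) = gpsSolutions Z d := by
  ext W
  simp only [gpsSolutions, gpsObjective_comp_perm]

theorem circlePower_expand (P : EuclideanSpace ℝ (Fin 2)) (r : ℝ)
    (V W : EuclideanSpace ℝ (Fin 2)) :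
    circlePower P r V =
      circlePower P r W + 2 * inner ℝ (W - P) (V - W) + ‖V - W‖ ^ 2 := by
  have h : V - P = (W - P) + (V - W) := by abel
  rw [circlePower, circlePower, h, norm_add_sq_real]
  ring

theorem continuous_circlePower (P : EuclideanSpace ℝ (Fin 2)) (r : ℝ) :
    Continuous (circlePower P r) := by
  unfold circlePower
  fun_prop

open Topology in
theorem exists_sign_eventually (P : EuclideanSpace ℝ (Fin 2)) (r : ℝ)
    {W : EuclideanSpace ℝ (Fin 2)} (h : circlePower P r W ≠ 0) :
    ∃ s : ℝ, (s = 1 ∨ s = -1) ∧ ∀ᶠ V in 𝓝 W, |circlePower P r V| = s * circlePower P r V := by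
  have hc := (continuous_circlePower P r).continuousAt (x := W)
  rcases h.lt_or_gt with h | h
  · refine ⟨-1, Or.inr rfl, ?_⟩
    filter_upwards [hc.eventually_lt_const h] with V hV
    rw [abs_of_neg hV]; ring
  · refine ⟨1, Or.inl rfl, ?_⟩
    filter_upwards [hc.eventually_const_lt h] with V hV
    rw [abs_of_pos hV]; ring

/-- A minimizer with multipliers of positive sum is the only minimizer. -/
theorem eq_of_multipliers {Z : Fin 3 → EuclideanSpace ℝ (Fin 2)} {d : Fin 3 → ℝ}
    {V W : EuclideanSpace ℝ (Fin 2)} {t₀ t₁ t₂ : ℝ} (h₀ : |t₀| ≤ 1) (h₁ : |t₁| ≤ 1)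
    (h₂ : |t₂| ≤ 1) (hW₀ : |circlePower (Z 0) (d 0) W| = t₀ * circlePower (Z 0) (d 0) W)
    (hW₁ : |circlePower (Z 1) (d 1) W| = t₁ * circlePower (Z 1) (d 1) W)
    (hW₂ : |circlePower (Z 2) (d 2) W| = t₂ * circlePower (Z 2) (d 2) W)
    (hG : t₀ • (W - Z 0) + t₁ • (W - Z 1) + t₂ • (W - Z 2) = 0) (hpos : 0 < t₀ + t₁ + t₂)
    (hV : gpsObjective Z d V ≤ gpsObjective Z d W) : V = W := by
  -- Replacing each `|fⱼ|` by `tⱼ fⱼ` gives a quadratic minorant of the objective that touches it at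
  -- `W`.
  have key : ∀ (t f : ℝ), |t| ≤ 1 → t * f ≤ |f| := fun t f ht =>
    (le_abs_self _).trans (by rw [abs_mul]; exact mul_le_of_le_one_left (abs_nonneg f) ht)
  have k₀ := key t₀ (circlePower (Z 0) (d 0) V) h₀
  have k₁ := key t₁ (circlePower (Z 1) (d 1) V) h₁
  have k₂ := key t₂ (circlePower (Z 2) (d 2) V) h₂
  rw [gpsObjective_eq_add, gpsObjective_eq_add, hW₀, hW₁, hW₂] at hV
  rw [circlePower_expand _ _ V W] at k₀ k₁ k₂
  rw [circlePower_expand (Z 0) _ V W, circlePower_expand (Z 1) _ V W,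
    circlePower_expand (Z 2) _ V W] at hV
  have hG' : t₀ * inner ℝ (W - Z 0) (V - W) + t₁ * inner ℝ (W - Z 1) (V - W) +
      t₂ * inner ℝ (W - Z 2) (V - W) = 0 := by
    have := congrArg (fun x => inner ℝ x (V - W)) hG
    simpa only [inner_add_left, real_inner_smul_left, inner_zero_left] using this
  have : (t₀ + t₁ + t₂) * ‖V - W‖ ^ 2 ≤ 0 := by linarith
  have h0 : ‖V - W‖ ^ 2 ≤ 0 := by
    by_contra h
    linarith [mul_pos hpos (not_le.1 h)]
  have : ‖V - W‖ = 0 := by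
    have := sq_nonneg ‖V - W‖
    exact pow_eq_zero_iff two_ne_zero |>.1 (le_antisymm h0 this)
  exact sub_eq_zero.1 (norm_eq_zero.1 this)

-- Put `V = W + t v`, divide by `t > 0` and let `t → 0`: the quadratic terms disappear.
open Topology Filter in
theorem first_order_condition {G n W : EuclideanSpace ℝ (Fin 2)} {m k : ℝ}
    (h : ∀ᶠ V in 𝓝 W, 0 ≤ 2 * inner ℝ G (V - W) + m * ‖V - W‖ ^ 2 +
      k * |2 * inner ℝ n (V - W) + ‖V - W‖ ^ 2|) (v : EuclideanSpace ℝ (Fin 2)) :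
    0 ≤ inner ℝ G v + k * |inner ℝ n v| := by
  have hW : Tendsto (fun t : ℝ => W + t • v) (𝓝[>] 0) (𝓝 W) := by
    have : Continuous fun t : ℝ => W + t • v := by fun_prop
    simpa using (this.tendsto 0).mono_left nhdsWithin_le_nhds
  have hlim : Tendsto (fun t : ℝ => 2 * inner ℝ G v + m * (t * ‖v‖ ^ 2) +
      k * |2 * inner ℝ n v + t * ‖v‖ ^ 2|) (𝓝[>] 0)
      (𝓝 (2 * inner ℝ G v + m * (0 * ‖v‖ ^ 2) + k * |2 * inner ℝ n v + 0 * ‖v‖ ^ 2|)) := by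
    have : Continuous fun t : ℝ => 2 * inner ℝ G v + m * (t * ‖v‖ ^ 2) +
      k * |2 * inner ℝ n v + t * ‖v‖ ^ 2| := by fun_prop
    exact (this.tendsto 0).mono_left nhdsWithin_le_nhds
  have := ge_of_tendsto hlim (b := 0) (by
    filter_upwards [hW.eventually h, self_mem_nhdsWithin] with t ht ht0
    have ht0 : 0 < t := ht0
    refine nonneg_of_mul_nonneg_right ?_ ht0
    have e : |2 * (t * inner ℝ n v) + (t * ‖v‖) ^ 2| =
        t * |2 * inner ℝ n v + t * ‖v‖ ^ 2| := by
      rw [← abs_of_pos ht0, ← abs_mul, abs_of_pos ht0]; congr 1; ring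
    rw [add_sub_cancel_left, inner_smul_right, inner_smul_right, norm_smul, Real.norm_eq_abs,
      abs_of_pos ht0, e] at ht
    linarith)
  rw [zero_mul, mul_zero, add_zero, add_zero, abs_mul, abs_two] at this
  linarith

theorem norm_sq_eq_coord (v : EuclideanSpace ℝ (Fin 2)) : ‖v‖ ^ 2 = v 0 ^ 2 + v 1 ^ 2 := by
  simp [EuclideanSpace.norm_sq_eq, Fin.sum_univ_two]

theorem inner_eq_coord (v w : EuclideanSpace ℝ (Fin 2)) :
    inner ℝ v w = v 0 * w 0 + v 1 * w 1 := by
  simp [PiLp.inner_apply, Fin.sum_univ_two, mul_comm]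

/-- If `|⟪G, v⟫| ≤ |⟪n, v⟫|` for all `v` then `G` is a multiple of `n` by a factor in `[-1, 1]`. -/
theorem exists_multiplier {G n : EuclideanSpace ℝ (Fin 2)} (hn : n ≠ 0)
    (h : ∀ v, 0 ≤ inner ℝ G v + |inner ℝ n v|) : ∃ τ : ℝ, |τ| ≤ 1 ∧ G + τ • n = 0 := by
  have hnn : 0 < ‖n‖ ^ 2 := by positivity
  have hnc := norm_sq_eq_coord n
  -- The two normals to `n` force `G` to be parallel to `n`; `n` and `-n` bound the factor.
  have p1 := h !₂[-n 1, n 0]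
  have p2 := h !₂[n 1, -n 0]
  have p3 := h n
  have p4 := h (-n)
  simp only [inner_eq_coord, PiLp.neg_apply, Matrix.cons_val_zero, Matrix.cons_val_one] at p1 p2 p3 p4
  rw [show n 0 * -n 1 + n 1 * n 0 = 0 by ring, abs_zero] at p1
  rw [show n 0 * n 1 + n 1 * -n 0 = 0 by ring, abs_zero] at p2
  rw [show n 0 * n 0 + n 1 * n 1 = ‖n‖ ^ 2 by rw [hnc]; ring, abs_of_pos hnn] at p3
  rw [show n 0 * -n 0 + n 1 * -n 1 = -‖n‖ ^ 2 by rw [hnc]; ring, abs_neg, abs_of_pos hnn] at p4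
  have hcross : G 0 * n 1 - G 1 * n 0 = 0 := by linarith
  refine ⟨-((G 0 * n 0 + G 1 * n 1) / ‖n‖ ^ 2), ?_, ?_⟩
  · rw [abs_neg, abs_le, le_div_iff₀ hnn, div_le_one hnn]
    constructor <;> linarith
  · ext i
    fin_cases i
    · simp only [Fin.zero_eta, PiLp.add_apply, PiLp.smul_apply, smul_eq_mul, PiLp.zero_apply]
      field_simp
      rw [hnc]
      linear_combination n 1 * hcross
    · simp only [Fin.mk_one, PiLp.add_apply, PiLp.smul_apply, smul_eq_mul, PiLp.zero_apply]
      field_simp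
      rw [hnc]
      linear_combination (-n 0) * hcross

open Topology Filter in
/-- On a nondegenerate circle there are other points of the circle near each point. -/
theorem exists_mem_circle_near {P W : EuclideanSpace ℝ (Fin 2)} (hn : W - P ≠ 0)
    {p : EuclideanSpace ℝ (Fin 2) → Prop} (hp : ∀ᶠ V in 𝓝 W, p V) :
    ∃ V, V ≠ W ∧ ‖V - P‖ ^ 2 = ‖W - P‖ ^ 2 ∧ p V := by
  set n := W - P with hn_def
  let γ : ℝ → EuclideanSpace ℝ (Fin 2) := fun θ =>
    P + (Real.cos θ • n + Real.sin θ • !₂[-n 1, n 0])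
  have hγ : Tendsto γ (𝓝[>] 0) (𝓝 W) := by
    have : Continuous γ := by fun_prop
    have h := (this.tendsto 0).mono_left (nhdsWithin_le_nhds (s := Set.Ioi 0))
    simpa [γ, hn_def] using h
  obtain ⟨θ, hθ, hθ0⟩ := ((hγ.eventually hp).and
    (Ioo_mem_nhdsGT Real.pi_pos)).exists
  refine ⟨γ θ, ?_, ?_, hθ⟩
  · intro h
    have hs := Real.sin_pos_of_pos_of_lt_pi hθ0.1 hθ0.2
    have h0 := congrArg (fun x => inner ℝ (x - P) !₂[-n 1, n 0]) h
    simp only [γ, add_sub_cancel_left, ← hn_def, inner_eq_coord, PiLp.add_apply, PiLp.smul_apply,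
      smul_eq_mul, Matrix.cons_val_zero, Matrix.cons_val_one] at h0
    have : Real.sin θ * ‖n‖ ^ 2 = 0 := by rw [norm_sq_eq_coord]; linarith
    have hnn : 0 < ‖n‖ ^ 2 := by positivity
    exact (mul_pos hs hnn).ne' this
  · simp only [γ, add_sub_cancel_left, norm_sq_eq_coord, PiLp.add_apply, PiLp.smul_apply,
      smul_eq_mul, Matrix.cons_val_zero, Matrix.cons_val_one]
    linear_combination (n 0 ^ 2 + n 1 ^ 2) * Real.sin_sq_add_cos_sq θ

open Topology Filter in
theorem exists_near_ne {W : EuclideanSpace ℝ (Fin 2)}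
    {p : EuclideanSpace ℝ (Fin 2) → Prop} (hp : ∀ᶠ V in 𝓝 W, p V) : ∃ V, V ≠ W ∧ p V :=
  ((hp.filter_mono nhdsWithin_le_nhds).and (self_mem_nhdsWithin (s := {W}ᶜ))).exists.imp
    fun _ h => ⟨h.2, h.1⟩

open Topology in
/-- A minimizer lying on at most one of the three circles is the only minimizer. -/
theorem gpsSolutions_eq_singleton_of_ne {Z : Fin 3 → EuclideanSpace ℝ (Fin 2)} {d : Fin 3 → ℝ}
    (hZ : Z 0 ≠ Z 1) {W : EuclideanSpace ℝ (Fin 2)} (hW : W ∈ gpsSolutions Z d)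
    (h₀ : circlePower (Z 0) (d 0) W ≠ 0) (h₁ : circlePower (Z 1) (d 1) W ≠ 0) :
    gpsSolutions Z d = {W} := by
  obtain ⟨s₀, hs₀, e₀⟩ := exists_sign_eventually _ _ h₀
  obtain ⟨s₁, hs₁, e₁⟩ := exists_sign_eventually _ _ h₁
  have abs_le_one : ∀ s : ℝ, s = 1 ∨ s = -1 → |s| ≤ 1 := by
    rintro s (rfl | rfl) <;> simp
  -- The multipliers off the circles are the signs; only the third remains to be found.
  suffices h : ∃ τ : ℝ, |τ| ≤ 1 ∧
      |circlePower (Z 2) (d 2) W| = τ * circlePower (Z 2) (d 2) W ∧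
      s₀ • (W - Z 0) + s₁ • (W - Z 1) + τ • (W - Z 2) = 0 ∧ 0 < s₀ + s₁ + τ by
    obtain ⟨τ, hτ, hτW, hG, hpos⟩ := h
    ext V
    rw [Set.mem_singleton_iff]
    refine ⟨fun hV => ?_, fun hV => hV ▸ hW⟩
    exact eq_of_multipliers (abs_le_one _ hs₀) (abs_le_one _ hs₁) hτ e₀.self_of_nhds
      e₁.self_of_nhds hτW hG hpos (hV W)
  -- near `W`, the objective is `f₀` and `f₁` with fixed signs plus `|f₂|`
  have hloc : ∀ᶠ V in 𝓝 W, 0 ≤ 2 * inner ℝ (s₀ • (W - Z 0) + s₁ • (W - Z 1)) (V - W) +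
      (s₀ + s₁) * ‖V - W‖ ^ 2 + (|circlePower (Z 2) (d 2) V| - |circlePower (Z 2) (d 2) W|) := by
    filter_upwards [e₀, e₁] with V k₀ k₁
    have := hW V
    rw [gpsObjective_eq_add, gpsObjective_eq_add, k₀, k₁, e₀.self_of_nhds, e₁.self_of_nhds,
      circlePower_expand (Z 0) _ V W, circlePower_expand (Z 1) _ V W] at this
    rw [inner_add_left, real_inner_smul_left, real_inner_smul_left]
    linarith
  by_cases h₂ : circlePower (Z 2) (d 2) W = 0
  · have hloc' : ∀ᶠ V in 𝓝 W, 0 ≤ 2 * inner ℝ (s₀ • (W - Z 0) + s₁ • (W - Z 1)) (V - W) +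
        (s₀ + s₁) * ‖V - W‖ ^ 2 + 1 * |2 * inner ℝ (W - Z 2) (V - W) + ‖V - W‖ ^ 2| := by
      filter_upwards [hloc] with V k
      rw [h₂, abs_zero, sub_zero, circlePower_expand _ _ V W, h₂, zero_add] at k
      rwa [one_mul]
    have hfirst := first_order_condition hloc'
    simp only [one_mul] at hfirst
    by_cases hn : W - Z 2 = 0
    · -- degenerate circle
      rw [hn] at hfirst hloc'
      simp only [inner_zero_left, abs_zero, add_zero] at hfirst
      have hG : s₀ • (W - Z 0) + s₁ • (W - Z 1) = 0 := by
        have := hfirst (-(s₀ • (W - Z 0) + s₁ • (W - Z 1)))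
        rw [inner_neg_right, real_inner_self_eq_norm_sq] at this
        have : ‖s₀ • (W - Z 0) + s₁ • (W - Z 1)‖ ^ 2 = 0 :=
          le_antisymm (by linarith) (sq_nonneg _)
        exact norm_eq_zero.1 (pow_eq_zero_iff two_ne_zero |>.1 this)
      -- At the center of a circle of radius zero the third gradient vanishes, so any multiplier is
      -- stationary and `0` suffices. Mixed signs then force `Z 0 = Z 1`, and two negative signs
      -- contradict local minimality.
      refine ⟨0, by simp, by simp [h₂], by rw [hG, zero_smul, zero_add], ?_⟩
      rcases hs₀ with rfl | rfl <;> rcases hs₁ with rfl | rfl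
      · norm_num
      · exfalso
        apply hZ
        rw [one_smul, neg_one_smul] at hG
        have : Z 1 - Z 0 = 0 := by rw [← hG]; abel
        exact (sub_eq_zero.1 this).symm
      · exfalso
        apply hZ
        rw [one_smul, neg_one_smul] at hG
        have : Z 0 - Z 1 = 0 := by rw [← hG]; abel
        exact sub_eq_zero.1 this
      · exfalso
        obtain ⟨V, hVW, hV⟩ := exists_near_ne hloc'
        rw [hG] at hV
        simp only [inner_zero_left, mul_zero, zero_add, one_mul, abs_pow, abs_norm] at hV
        have : 0 < ‖V - W‖ ^ 2 := by have := sub_ne_zero.2 hVW; positivity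
        linarith
    · obtain ⟨τ, hτ, hG⟩ := exists_multiplier hn hfirst
      refine ⟨τ, hτ, by simp [h₂], hG, ?_⟩
      -- moving along the third circle shows that the sum is nonnegative
      have hnonneg : 0 ≤ s₀ + s₁ + τ := by
        obtain ⟨V, hVW, hVc, hV⟩ := exists_mem_circle_near hn hloc'
        have hin : 2 * inner ℝ (W - Z 2) (V - W) + ‖V - W‖ ^ 2 = 0 := by
          have := circlePower_expand (Z 2) (d 2) V W
          unfold circlePower at this
          linarith
        rw [hin, abs_zero, mul_zero, add_zero, eq_neg_of_add_eq_zero_left hG, inner_neg_left,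
          real_inner_smul_left] at hV
        have hpos : 0 < ‖V - W‖ ^ 2 := by have := sub_ne_zero.2 hVW; positivity
        have : 0 ≤ (s₀ + s₁ + τ) * ‖V - W‖ ^ 2 := by linear_combination hV - τ * hin
        exact nonneg_of_mul_nonneg_left this hpos
      -- Sum zero with `|τ| ≤ 1` needs opposite signs and `τ = 0`, whence `Z 0 = Z 1`.
      refine lt_of_le_of_ne hnonneg fun hsum => ?_
      have hτ' := abs_le.1 hτ
      rcases hs₀ with rfl | rfl <;> rcases hs₁ with rfl | rfl
      · linarith
      · have : τ = 0 := by linarith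
        subst this
        apply hZ
        rw [one_smul, neg_one_smul, zero_smul, add_zero] at hG
        have : Z 1 - Z 0 = 0 := by rw [← hG]; abel
        exact (sub_eq_zero.1 this).symm
      · have : τ = 0 := by linarith
        subst this
        apply hZ
        rw [one_smul, neg_one_smul, zero_smul, add_zero] at hG
        have : Z 0 - Z 1 = 0 := by rw [← hG]; abel
        exact sub_eq_zero.1 this
      · linarith
  · obtain ⟨s₂, hs₂, e₂⟩ := exists_sign_eventually _ _ h₂
    have hloc' : ∀ᶠ V in 𝓝 W, 0 ≤
        2 * inner ℝ (s₀ • (W - Z 0) + s₁ • (W - Z 1) + s₂ • (W - Z 2)) (V - W) +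
        (s₀ + s₁ + s₂) * ‖V - W‖ ^ 2 + 0 * |2 * inner ℝ (0 : EuclideanSpace ℝ (Fin 2)) (V - W) +
          ‖V - W‖ ^ 2| := by
      filter_upwards [hloc, e₂] with V k k₂
      rw [k₂, e₂.self_of_nhds, circlePower_expand _ _ V W] at k
      rw [inner_add_left _ (s₂ • _), real_inner_smul_left _ _ s₂]
      linarith
    have hfirst := first_order_condition hloc'
    simp only [zero_mul, add_zero] at hfirst hloc'
    have hG : s₀ • (W - Z 0) + s₁ • (W - Z 1) + s₂ • (W - Z 2) = 0 := by
      have := hfirst (-(s₀ • (W - Z 0) + s₁ • (W - Z 1) + s₂ • (W - Z 2)))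
      rw [inner_neg_right, real_inner_self_eq_norm_sq] at this
      have : ‖s₀ • (W - Z 0) + s₁ • (W - Z 1) + s₂ • (W - Z 2)‖ ^ 2 = 0 :=
        le_antisymm (by linarith) (sq_nonneg _)
      exact norm_eq_zero.1 (pow_eq_zero_iff two_ne_zero |>.1 this)
    refine ⟨s₂, abs_le_one _ hs₂, e₂.self_of_nhds, hG, ?_⟩
    have hnonneg : 0 ≤ s₀ + s₁ + s₂ := by
      obtain ⟨V, hVW, hV⟩ := exists_near_ne hloc'
      rw [hG, inner_zero_left, mul_zero, zero_add] at hV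
      have hpos : 0 < ‖V - W‖ ^ 2 := by have := sub_ne_zero.2 hVW; positivity
      exact nonneg_of_mul_nonneg_left hV hpos
    refine lt_of_le_of_ne hnonneg fun hsum => ?_
    rcases hs₀ with rfl | rfl <;> rcases hs₁ with rfl | rfl <;> rcases hs₂ with rfl | rfl <;>
      norm_num at hsum

/-! ### Common points of two circles and the count of minimizers -/

theorem circlePower_eq_coord (P : EuclideanSpace ℝ (Fin 2)) (r : ℝ)
    (W : EuclideanSpace ℝ (Fin 2)) :
    circlePower P r W = (W 0 - P 0) ^ 2 + (W 1 - P 1) ^ 2 - r ^ 2 := by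
  rw [circlePower, norm_sq_eq_coord, PiLp.sub_apply, PiLp.sub_apply]

theorem dist_sq_eq_coord (A B : EuclideanSpace ℝ (Fin 2)) :
    dist A B ^ 2 = (A 0 - B 0) ^ 2 + (A 1 - B 1) ^ 2 := by
  rw [dist_eq_norm, norm_sq_eq_coord, PiLp.sub_apply, PiLp.sub_apply]

theorem dist_eq_of_circlePower_eq_zero {P W : EuclideanSpace ℝ (Fin 2)} {r : ℝ} (hr : 0 ≤ r)
    (h : circlePower P r W = 0) : dist W P = r := by
  rw [dist_eq_norm]
  exact (sq_eq_sq₀ (norm_nonneg _) hr).1 (sub_eq_zero.1 h)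

theorem coord_ne_of_ne {A B : EuclideanSpace ℝ (Fin 2)} (h : A ≠ B) :
    ¬(A 0 - B 0 = 0 ∧ A 1 - B 1 = 0) := by
  rintro ⟨h0, h1⟩
  apply h
  ext i
  fin_cases i
  · exact sub_eq_zero.1 h0
  · exact sub_eq_zero.1 h1

/-- The common points of the circles `i` and `j` that are minimizers. -/
def pairSolutions (Z : Fin 3 → EuclideanSpace ℝ (Fin 2)) (d : Fin 3 → ℝ) (i j : Fin 3) :
    Set (EuclideanSpace ℝ (Fin 2)) :=
  {W | W ∈ gpsSolutions Z d ∧ circlePower (Z i) (d i) W = 0 ∧ circlePower (Z j) (d j) W = 0}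

theorem pairSolutions_comm (Z : Fin 3 → EuclideanSpace ℝ (Fin 2)) (d : Fin 3 → ℝ) (i j : Fin 3) :
    pairSolutions Z d i j = pairSolutions Z d j i := by
  ext W
  simp only [pairSolutions, Set.mem_ofPred_eq, and_comm]

theorem pairSolutions_comp_perm (Z : Fin 3 → EuclideanSpace ℝ (Fin 2)) (d : Fin 3 → ℝ)
    (σ : Equiv.Perm (Fin 3)) (i j : Fin 3) :
    pairSolutions (Z ∘ σ) (d ∘ σ) i j = pairSolutions Z d (σ i) (σ j) := by
  simp only [pairSolutions, gpsSolutions_comp_perm, Function.comp_apply]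

theorem exists_subset_pair {P Q : EuclideanSpace ℝ (Fin 2)} (hPQ : P ≠ Q) {r s : ℝ} (hr : 0 ≤ r)
    (hs : 0 ≤ s) : ∃ x y, {W | circlePower P r W = 0 ∧ circlePower Q s W = 0} ⊆ {x, y} := by
  by_cases h : ∃ x y, x ≠ y ∧ (circlePower P r x = 0 ∧ circlePower Q s x = 0) ∧
      (circlePower P r y = 0 ∧ circlePower Q s y = 0)
  · obtain ⟨x, y, hxy, hx, hy⟩ := h
    refine ⟨x, y, fun W hW => ?_⟩
    exact EuclideanGeometry.eq_of_dist_eq_of_dist_eq_of_finrank_eq_two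
      (finrank_euclideanSpace_fin (𝕜 := ℝ)) hPQ hxy
      (dist_eq_of_circlePower_eq_zero hr hx.1) (dist_eq_of_circlePower_eq_zero hr hy.1)
      (dist_eq_of_circlePower_eq_zero hr hW.1) (dist_eq_of_circlePower_eq_zero hs hx.2)
      (dist_eq_of_circlePower_eq_zero hs hy.2) (dist_eq_of_circlePower_eq_zero hs hW.2)
  · push Not at h
    by_cases h' : ∃ x, circlePower P r x = 0 ∧ circlePower Q s x = 0
    · obtain ⟨x, hx⟩ := h'
      refine ⟨x, x, fun W hW => Or.inl ?_⟩
      by_contra hne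
      exact h W x hne hW hx.1 hx.2
    · exact ⟨0, 0, fun W hW => absurd ⟨W, hW⟩ h'⟩

theorem ncard_le_two_of_subset_pair {α : Type*} {s : Set α} {x y : α} (h : s ⊆ {x, y}) :
    s.ncard ≤ 2 :=
  (Set.ncard_le_ncard h (Set.toFinite _)).trans (Set.ncard_insert_le _ _ |>.trans (by simp))

theorem ncard_pairSolutions_le {Z : Fin 3 → EuclideanSpace ℝ (Fin 2)} {d : Fin 3 → ℝ}
    (hZ : Function.Injective Z) (hd : ∀ j, 0 ≤ d j) {i j : Fin 3} (hij : i ≠ j) :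
    (pairSolutions Z d i j).ncard ≤ 2 := by
  obtain ⟨x, y, h⟩ := exists_subset_pair (hZ.ne hij) (hd i) (hd j)
  exact ncard_le_two_of_subset_pair fun W hW => h hW.2

theorem conditions_of_pairSolutions {Z : Fin 3 → EuclideanSpace ℝ (Fin 2)} {d : Fin 3 → ℝ}
    (hZ : Function.Injective Z) (hd : ∀ j, 0 ≤ d j)
    (hpos : ∀ W ∈ gpsSolutions Z d, 0 < gpsObjective Z d W)
    (h02 : (pairSolutions Z d 0 2).ncard = 2) (h12 : (pairSolutions Z d 1 2).ncard = 2)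
    (h01 : (pairSolutions Z d 0 1).Nonempty) :
    FiveSolutionConditions (Z 0) (Z 1) (Z 2) (d 0) (d 1) (d 2) := by
  obtain ⟨w, w', hww, hw⟩ := Set.ncard_eq_two.1 h02
  obtain ⟨v, v', hvv, hv⟩ := Set.ncard_eq_two.1 h12
  obtain ⟨u, hu⟩ := h01
  have mw : w ∈ pairSolutions Z d 0 2 := by rw [hw]; simp
  have mw' : w' ∈ pairSolutions Z d 0 2 := by rw [hw]; simp
  have mv : v ∈ pairSolutions Z d 1 2 := by rw [hv]; simp
  have mv' : v' ∈ pairSolutions Z d 1 2 := by rw [hv]; simp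
  have hval : ∀ x ∈ gpsSolutions Z d, gpsObjective Z d x = gpsObjective Z d u :=
    fun x hx => le_antisymm (hx u) (hu.1 x)
  have sq1 : ∀ x ∈ pairSolutions Z d 0 2,
      circlePower (Z 1) (d 1) x ^ 2 = gpsObjective Z d u ^ 2 := by
    rintro x ⟨hx, h0, h2⟩
    rw [← hval x hx, gpsObjective_eq_add, h0, h2, abs_zero, zero_add, add_zero, sq_abs]
  have sq0 : ∀ x ∈ pairSolutions Z d 1 2,
      circlePower (Z 0) (d 0) x ^ 2 = gpsObjective Z d u ^ 2 := by
    rintro x ⟨hx, h0, h2⟩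
    rw [← hval x hx, gpsObjective_eq_add, h0, h2, abs_zero, add_zero, add_zero, sq_abs]
  have sq2 : circlePower (Z 2) (d 2) u ^ 2 = gpsObjective Z d u ^ 2 := by
    rw [gpsObjective_eq_add, hu.2.1, hu.2.2, abs_zero, zero_add, zero_add, sq_abs]
  have trans_sq : ∀ x y z : ℝ, x - z - (y - z) = x - y := fun x y z => by ring
  -- Coordinates are taken relative to `Z 2`, the center shared by the two full pairs.
  have hmin : ∀ x y : ℝ, (x - (Z 0 0 - Z 2 0)) ^ 2 + (y - (Z 0 1 - Z 2 1)) ^ 2 = d 0 ^ 2 →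
      (x - (Z 1 0 - Z 2 0)) ^ 2 + (y - (Z 1 1 - Z 2 1)) ^ 2 = d 1 ^ 2 →
      gpsObjective Z d u ^ 2 ≤ (x ^ 2 + y ^ 2 - d 2 ^ 2) ^ 2 := by
    intro x y hx hy
    have k0 : circlePower (Z 0) (d 0) !₂[x + Z 2 0, y + Z 2 1] = 0 := by
      rw [circlePower_eq_coord, ← hx]
      simp only [Matrix.cons_val_zero, Matrix.cons_val_one]
      ring
    have k1 : circlePower (Z 1) (d 1) !₂[x + Z 2 0, y + Z 2 1] = 0 := by
      rw [circlePower_eq_coord, ← hy]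
      simp only [Matrix.cons_val_zero, Matrix.cons_val_one]
      ring
    have k2 : circlePower (Z 2) (d 2) !₂[x + Z 2 0, y + Z 2 1] = x ^ 2 + y ^ 2 - d 2 ^ 2 := by
      rw [circlePower_eq_coord]
      simp only [Matrix.cons_val_zero, Matrix.cons_val_one, add_sub_cancel_right]
    have := hu.1 !₂[x + Z 2 0, y + Z 2 1]
    rw [gpsObjective_eq_add _ _ !₂[x + Z 2 0, y + Z 2 1], k0, k1, k2, abs_zero, zero_add,
      zero_add] at this
    rw [← sq_abs (x ^ 2 + y ^ 2 - d 2 ^ 2)]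
    exact pow_le_pow_left₀ (hpos u hu.1).le this 2
  have sub_ne : ∀ {x y : EuclideanSpace ℝ (Fin 2)}, x ≠ y →
      ¬(x 0 - Z 2 0 - (y 0 - Z 2 0) = 0 ∧ x 1 - Z 2 1 - (y 1 - Z 2 1) = 0) := by
    intro x y h
    rw [trans_sq, trans_sq]
    exact coord_ne_of_ne h
  have onC : ∀ {i : Fin 3} {x : EuclideanSpace ℝ (Fin 2)}, circlePower (Z i) (d i) x = 0 →
      (x 0 - Z 2 0 - (Z i 0 - Z 2 0)) ^ 2 + (x 1 - Z 2 1 - (Z i 1 - Z 2 1)) ^ 2 = d i ^ 2 := by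
    intro i x h
    rw [trans_sq, trans_sq]
    exact sub_eq_zero.1 ((circlePower_eq_coord _ _ _).symm.trans h)
  have onC2 : ∀ {x : EuclideanSpace ℝ (Fin 2)}, circlePower (Z 2) (d 2) x = 0 →
      (x 0 - Z 2 0) ^ 2 + (x 1 - Z 2 1) ^ 2 = d 2 ^ 2 :=
    fun h => sub_eq_zero.1 ((circlePower_eq_coord _ _ _).symm.trans h)
  have pw : ∀ {i : Fin 3} {x : EuclideanSpace ℝ (Fin 2)},
      circlePower (Z i) (d i) x ^ 2 = gpsObjective Z d u ^ 2 →
      ((x 0 - Z 2 0 - (Z i 0 - Z 2 0)) ^ 2 + (x 1 - Z 2 1 - (Z i 1 - Z 2 1)) ^ 2 - d i ^ 2) ^ 2 =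
        gpsObjective Z d u ^ 2 := by
    intro i x h
    rw [trans_sq, trans_sq, ← circlePower_eq_coord, h]
  obtain ⟨c1, c2, c3, c4, c5⟩ := conditions_of_five_points (hpos u hu.1)
    (coord_ne_of_ne (hZ.ne (by decide : (1 : Fin 3) ≠ 2)))
    (sub_ne hww) (sub_ne hvv)
    (onC2 mw.2.2) (onC mw.2.1) (pw (sq1 w mw)) (onC2 mw'.2.2) (onC mw'.2.1) (pw (sq1 w' mw'))
    (onC2 mv.2.2) (onC mv.2.1) (pw (sq0 v mv)) (onC2 mv'.2.2) (onC mv'.2.1) (pw (sq0 v' mv'))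
    (onC hu.2.1) (onC hu.2.2)
    (by rw [← circlePower_eq_coord]; exact sq2) hmin
  rw [trans_sq, trans_sq] at c2 c3
  simp only [← dist_sq_eq_coord] at c1 c2 c3 c4
  refine ⟨(sq_eq_sq₀ dist_nonneg dist_nonneg).1 c1, lt_of_pow_lt_pow_left₀ 2 dist_nonneg c2, c3, ?_,
    (sq_eq_sq₀ (hd 1) (hd 0)).1 c5⟩
  rw [← c4, Real.sqrt_sq (hd 2)]

theorem exists_conditions_of_ncard_eq_five {Z : Fin 3 → EuclideanSpace ℝ (Fin 2)} {d : Fin 3 → ℝ}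
    (hZ : Function.Injective Z) (hd : ∀ j, 0 ≤ d j) (h5 : (gpsSolutions Z d).ncard = 5) :
    ∃ σ : Equiv.Perm (Fin 3),
      FiveSolutionConditions (Z (σ 0)) (Z (σ 1)) (Z (σ 2)) (d (σ 0)) (d (σ 1)) (d (σ 2)) := by
  have hpair : ∀ i j : Fin 3, i ≠ j → ∀ W ∈ gpsSolutions Z d,
      circlePower (Z i) (d i) W = 0 ∨ circlePower (Z j) (d j) W = 0 := by
    intro i j hij W hW
    by_contra! h
    obtain ⟨σ, rfl, rfl⟩ : ∃ σ : Equiv.Perm (Fin 3), σ 0 = i ∧ σ 1 = j := by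
      clear hW h
      revert i j
      decide
    rw [← gpsSolutions_comp_perm Z d σ] at hW h5
    rw [gpsSolutions_eq_singleton_of_ne (Z := Z ∘ σ) (d := d ∘ σ) (hZ.ne hij) hW h.1 h.2,
      Set.ncard_singleton] at h5
    omega
  have hpos : ∀ W ∈ gpsSolutions Z d, 0 < gpsObjective Z d W := by
    intro W hW
    by_contra hneg
    obtain ⟨x, y, h⟩ := exists_subset_pair (hZ.ne (by decide : (0 : Fin 3) ≠ 1)) (hd 0) (hd 1)
    have : (gpsSolutions Z d).ncard ≤ 2 := by
      refine ncard_le_two_of_subset_pair fun V hV => h ?_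
      have hle : gpsObjective Z d V ≤ 0 := (hV W).trans (not_lt.1 hneg)
      rw [gpsObjective_eq_add] at hle
      have n0 := abs_nonneg (circlePower (Z 0) (d 0) V)
      have n1 := abs_nonneg (circlePower (Z 1) (d 1) V)
      have n2 := abs_nonneg (circlePower (Z 2) (d 2) V)
      exact ⟨abs_eq_zero.1 (by linarith), abs_eq_zero.1 (by linarith)⟩
    omega
  have hcover : gpsSolutions Z d ⊆
      pairSolutions Z d 0 1 ∪ pairSolutions Z d 0 2 ∪ pairSolutions Z d 1 2 := by
    intro W hW
    simp only [pairSolutions, Set.mem_union, Set.mem_ofPred_eq]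
    have a := hpair 0 1 (by decide) W hW
    have b := hpair 0 2 (by decide) W hW
    have c := hpair 1 2 (by decide) W hW
    tauto
  have b01 := ncard_pairSolutions_le hZ hd (by decide : (0 : Fin 3) ≠ 1)
  have b02 := ncard_pairSolutions_le hZ hd (by decide : (0 : Fin 3) ≠ 2)
  have b12 := ncard_pairSolutions_le hZ hd (by decide : (1 : Fin 3) ≠ 2)
  -- `Set.ncard` is `0` on infinite sets, so the value 5 forces finiteness.
  have hfin : (gpsSolutions Z d).Finite := Set.finite_of_ncard_ne_zero (by omega)
  have hle : 5 ≤ (pairSolutions Z d 0 1).ncard + (pairSolutions Z d 0 2).ncard +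
      (pairSolutions Z d 1 2).ncard := by
    have fin_pair : ∀ i j, (pairSolutions Z d i j).Finite := fun i j =>
      hfin.subset fun W hW => hW.1
    rw [← h5]
    refine (Set.ncard_le_ncard hcover
      (((fin_pair 0 1).union (fin_pair 0 2)).union (fin_pair 1 2))).trans ?_
    exact (Set.ncard_union_le _ _).trans (Nat.add_le_add_right (Set.ncard_union_le _ _) _)
  have concl : ∀ σ : Equiv.Perm (Fin 3), (pairSolutions Z d (σ 0) (σ 2)).ncard = 2 →
      (pairSolutions Z d (σ 1) (σ 2)).ncard = 2 → (pairSolutions Z d (σ 0) (σ 1)).ncard ≠ 0 →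
      FiveSolutionConditions (Z (σ 0)) (Z (σ 1)) (Z (σ 2)) (d (σ 0)) (d (σ 1)) (d (σ 2)) := by
    intro σ h1 h2 h3
    rw [← pairSolutions_comp_perm] at h1 h2 h3
    refine conditions_of_pairSolutions (Z := Z ∘ σ) (d := d ∘ σ) (hZ.comp σ.injective)
      (fun j => hd _) ?_ h1 h2 (Set.nonempty_of_ncard_ne_zero h3)
    intro W hW
    rw [gpsSolutions_comp_perm] at hW
    rw [gpsObjective_comp_perm]
    exact hpos W hW
  -- Three numbers at most 2 with sum at least 5: two equal 2 and the third is nonzero. The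
  -- permutation sends the circle shared by two full pairs to the last place.
  by_cases h1 : (pairSolutions Z d 0 1).ncard = 2
  · by_cases h2 : (pairSolutions Z d 0 2).ncard = 2
    · refine ⟨Equiv.swap 0 2, concl _ ?_ ?_ ?_⟩
      · change (pairSolutions Z d 2 0).ncard = 2
        rwa [pairSolutions_comm]
      · change (pairSolutions Z d 1 0).ncard = 2
        rwa [pairSolutions_comm]
      · change (pairSolutions Z d 2 1).ncard ≠ 0
        rw [pairSolutions_comm]
        omega
    · refine ⟨Equiv.swap 1 2, concl _ ?_ ?_ ?_⟩
      · exact h1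
      · change (pairSolutions Z d 2 1).ncard = 2
        rw [pairSolutions_comm]
        omega
      · change (pairSolutions Z d 0 2).ncard ≠ 0
        omega
  · exact ⟨1, concl 1 (by change (pairSolutions Z d 0 2).ncard = 2; omega)
      (by change (pairSolutions Z d 1 2).ncard = 2; omega)
      (by change (pairSolutions Z d 0 1).ncard ≠ 0; omega)⟩

/-! ### Sufficiency through canonical coordinates -/

/-- In suitable coordinates adapted to an isosceles triangle the three powers become, up to a common
factor, quadratic polynomials with one parameter. -/
theorem powers_in_canonical_coordinates {p₁ q₁ p₂ q₂ l L b a c P R w₀ w₁ : ℝ}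
    (hL₁ : p₁ ^ 2 + q₁ ^ 2 = L) (hL₂ : p₂ ^ 2 + q₂ ^ 2 = L)
    (hb : (p₁ - p₂) ^ 2 + (q₁ - q₂) ^ 2 = b) (hl : 4 * l * (L - b) = b)
    (hc : c = 16 * l * (1 + 4 * l) * (L - b / 4)) (ha : a = L + c)
    (hw₀ : w₀ = P * (2 * l) * (p₁ + p₂) + R * (2 * (1 + 3 * l)) * (p₁ - p₂))
    (hw₁ : w₁ = P * (2 * l) * (q₁ + q₂) + R * (2 * (1 + 3 * l)) * (q₁ - q₂)) :
    w₀ ^ 2 + w₁ ^ 2 - c =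
      16 * l * (L - b / 4) * (l * P ^ 2 + (1 + 3 * l) * R ^ 2 - (1 + 4 * l)) ∧
    (w₀ - p₁) ^ 2 + (w₁ - q₁) ^ 2 - a = 16 * l * (L - b / 4) *
      (l * P ^ 2 + (1 + 3 * l) * R ^ 2 - (1 + 4 * l) - (P + R) / 2) ∧
    (w₀ - p₂) ^ 2 + (w₁ - q₂) ^ 2 - a = 16 * l * (L - b / 4) *
      (l * P ^ 2 + (1 + 3 * l) * R ^ 2 - (1 + 4 * l) - (P - R) / 2) := by
  have hN : w₀ ^ 2 + w₁ ^ 2 - c =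
      16 * l * (L - b / 4) * (l * P ^ 2 + (1 + 3 * l) * R ^ 2 - (1 + 4 * l)) := by
    rw [hw₀, hw₁]
    linear_combination 4 * l ^ 2 * P ^ 2 * (2 * hL₁ + 2 * hL₂ - hb) +
      4 * (1 + 3 * l) ^ 2 * R ^ 2 * hb + 8 * l * (1 + 3 * l) * P * R * (hL₁ - hL₂) -
      4 * (1 + 3 * l) * R ^ 2 * hl - hc
  have h₁ : w₀ * p₁ + w₁ * q₁ = 4 * l * (L - b / 4) * (P + R) := by
    rw [hw₀, hw₁]
    linear_combination l * P * (3 * hL₁ + hL₂ - hb) + (1 + 3 * l) * R * (hL₁ - hL₂ + hb) - R * hl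
  have h₂ : w₀ * p₂ + w₁ * q₂ = 4 * l * (L - b / 4) * (P - R) := by
    rw [hw₀, hw₁]
    linear_combination l * P * (3 * hL₂ + hL₁ - hb) - (1 + 3 * l) * R * (hL₂ - hL₁ + hb) + R * hl
  refine ⟨hN, ?_, ?_⟩
  · linear_combination hN - 2 * h₁ + hL₁ - ha
  · linear_combination hN - 2 * h₂ + hL₂ - ha

theorem ncard_eq_five_of_conditions {Z : Fin 3 → EuclideanSpace ℝ (Fin 2)} {d : Fin 3 → ℝ}
    (hZ : Z 0 ≠ Z 1)
    (h : FiveSolutionConditions (Z 0) (Z 1) (Z 2) (d 0) (d 1) (d 2)) :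
    (gpsSolutions Z d).ncard = 5 := by
  obtain ⟨h1, h2, h3, h4, h5⟩ := h
  have hbpos : 0 < dist (Z 0) (Z 1) ^ 2 := by have := dist_pos.2 hZ; positivity
  have hbL : dist (Z 0) (Z 1) ^ 2 < dist (Z 0) (Z 2) ^ 2 :=
    pow_lt_pow_left₀ h2 dist_nonneg two_ne_zero
  have hL₂ : (Z 1 0 - Z 2 0) ^ 2 + (Z 1 1 - Z 2 1) ^ 2 = dist (Z 0) (Z 2) ^ 2 := by
    rw [← dist_sq_eq_coord, h1]
  have hL₁ := (dist_sq_eq_coord (Z 0) (Z 2)).symm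
  have hb : (Z 0 0 - Z 2 0 - (Z 1 0 - Z 2 0)) ^ 2 + (Z 0 1 - Z 2 1 - (Z 1 1 - Z 2 1)) ^ 2 =
      dist (Z 0) (Z 1) ^ 2 := by
    rw [dist_sq_eq_coord]; ring
  generalize hLdef : dist (Z 0) (Z 2) ^ 2 = L at *
  generalize hbdef : dist (Z 0) (Z 1) ^ 2 = b at *
  have hLb : 0 < L - b := sub_pos.2 hbL
  have hLbne := hLb.ne'
  -- This `l` makes the coefficients of `P²` and `R²` equal `l` and `1 + 3 l` after the common
  -- factor `16 l (L - b / 4)` is removed.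
  obtain ⟨l, hldef⟩ : ∃ l, l = b / (4 * (L - b)) := ⟨_, rfl⟩
  have hl : 4 * l * (L - b) = b := by rw [hldef]; field_simp
  have hlpos : 0 < l := by rw [hldef]; positivity
  have hK : 0 < 16 * l * (L - b / 4) := mul_pos (by positivity) (by linarith)
  have hac : d 0 ^ 2 - L = 16 * l * (1 + 4 * l) * (L - b / 4) := by
    rw [h3, hldef]
    field_simp
    ring
  have hc : d 2 ^ 2 = 16 * l * (1 + 4 * l) * (L - b / 4) := by
    rw [h4, Real.sq_sqrt, hac]
    rw [hac]
    nlinarith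
  have ha : d 0 ^ 2 = L + d 2 ^ 2 := by rw [hc, ← hac]; ring
  -- the coordinates
  obtain ⟨φ, hφ⟩ : ∃ φ : ℝ × ℝ → EuclideanSpace ℝ (Fin 2), ∀ x, φ x =
    !₂[Z 2 0 + (x.1 * (2 * l) * (Z 0 0 - Z 2 0 + (Z 1 0 - Z 2 0)) +
        x.2 * (2 * (1 + 3 * l)) * (Z 0 0 - Z 2 0 - (Z 1 0 - Z 2 0))),
      Z 2 1 + (x.1 * (2 * l) * (Z 0 1 - Z 2 1 + (Z 1 1 - Z 2 1)) +
        x.2 * (2 * (1 + 3 * l)) * (Z 0 1 - Z 2 1 - (Z 1 1 - Z 2 1)))] := ⟨_, fun _ => rfl⟩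
  have hφ0 : ∀ x, φ x 0 - Z 2 0 = x.1 * (2 * l) * (Z 0 0 - Z 2 0 + (Z 1 0 - Z 2 0)) +
        x.2 * (2 * (1 + 3 * l)) * (Z 0 0 - Z 2 0 - (Z 1 0 - Z 2 0)) := fun x => by
    rw [hφ]; simp only [Matrix.cons_val_zero, add_sub_cancel_left]
  have hφ1 : ∀ x, φ x 1 - Z 2 1 = x.1 * (2 * l) * (Z 0 1 - Z 2 1 + (Z 1 1 - Z 2 1)) +
        x.2 * (2 * (1 + 3 * l)) * (Z 0 1 - Z 2 1 - (Z 1 1 - Z 2 1)) := fun x => by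
    rw [hφ]; simp only [Matrix.cons_val_one, Matrix.cons_val_zero, add_sub_cancel_left]
  have hobj : ∀ x, gpsObjective Z d (φ x) = 16 * l * (L - b / 4) *
      (|l * x.1 ^ 2 + (1 + 3 * l) * x.2 ^ 2 - (1 + 4 * l)| +
      |l * x.1 ^ 2 + (1 + 3 * l) * x.2 ^ 2 - (1 + 4 * l) - (x.1 + x.2) / 2| +
      |l * x.1 ^ 2 + (1 + 3 * l) * x.2 ^ 2 - (1 + 4 * l) - (x.1 - x.2) / 2|) := by
    intro x
    obtain ⟨k2, k0, k1⟩ := powers_in_canonical_coordinates hL₁ hL₂ hb hl hc ha (hφ0 x) (hφ1 x)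
    rw [sub_sub_sub_cancel_right, sub_sub_sub_cancel_right] at k0 k1
    rw [gpsObjective_eq_add, circlePower_eq_coord, circlePower_eq_coord, circlePower_eq_coord, h5,
      k0, k1, k2, abs_mul (16 * l * (L - b / 4)), abs_mul (16 * l * (L - b / 4)),
      abs_mul (16 * l * (L - b / 4)), abs_of_pos hK]
    ring
  -- the coordinates are a bijection
  have hΔ : (Z 0 0 - Z 2 0 + (Z 1 0 - Z 2 0)) * (Z 0 1 - Z 2 1 - (Z 1 1 - Z 2 1)) -
      (Z 0 1 - Z 2 1 + (Z 1 1 - Z 2 1)) * (Z 0 0 - Z 2 0 - (Z 1 0 - Z 2 0)) ≠ 0 := by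
    intro h0
    -- Lagrange's identity for the sum and the difference of the two sides: they are orthogonal,
    -- with squared lengths `4 L - b` and `b`.
    have : b * (4 * L - b) = 0 := by
      generalize Z 0 0 - Z 2 0 = p₁ at *
      generalize Z 0 1 - Z 2 1 = q₁ at *
      generalize Z 1 0 - Z 2 0 = p₂ at *
      generalize Z 1 1 - Z 2 1 = q₂ at *
      have hst : (p₁ + p₂) * (p₁ - p₂) + (q₁ + q₂) * (q₁ - q₂) = 0 := by
        linear_combination hL₁ - hL₂
      have hs : (p₁ + p₂) ^ 2 + (q₁ + q₂) ^ 2 = 4 * L - b := by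
        linear_combination 2 * hL₁ + 2 * hL₂ - hb
      rw [← hs, ← hb]
      linear_combination ((p₁ + p₂) * (q₁ - q₂) - (q₁ + q₂) * (p₁ - p₂)) * h0 +
        ((p₁ + p₂) * (p₁ - p₂) + (q₁ + q₂) * (q₁ - q₂)) * hst
    exact (mul_pos hbpos (by linarith : 0 < 4 * L - b)).ne' this
  have hl3 : 0 < 1 + 3 * l := by linarith
  have hinj : Function.Injective φ := by
    intro x y hxy
    have e0 := (hφ0 x).symm.trans ((congrArg (fun W => W 0 - Z 2 0) hxy).trans (hφ0 y))
    have e1 := (hφ1 x).symm.trans ((congrArg (fun W => W 1 - Z 2 1) hxy).trans (hφ1 y))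
    obtain ⟨r1, r2⟩ := eq_zero_of_dot_eq_zero (x := (x.1 - y.1) * (2 * l))
      (y := (x.2 - y.2) * (2 * (1 + 3 * l))) hΔ (by linear_combination e0)
      (by linear_combination e1)
    ext
    · exact sub_eq_zero.1 ((mul_eq_zero.1 r1).resolve_right (by positivity))
    · exact sub_eq_zero.1 ((mul_eq_zero.1 r2).resolve_right (by positivity))
  have hsurj : Function.Surjective φ := by
    intro W
    obtain ⟨x, y, h0, h1⟩ := exists_eq_linear_combination hΔ (W 0 - Z 2 0) (W 1 - Z 2 1)
    refine ⟨(x / (2 * l), y / (2 * (1 + 3 * l))), ?_⟩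
    ext i
    apply sub_left_injective (b := Z 2 i)
    fin_cases i
    · refine (hφ0 _).trans (Eq.trans ?_ h0)
      rw [div_mul_cancel₀ _ (by positivity), div_mul_cancel₀ _ (by positivity)]
    · refine (hφ1 _).trans (Eq.trans ?_ h1)
      rw [div_mul_cancel₀ _ (by positivity), div_mul_cancel₀ _ (by positivity)]
  have hX : gpsSolutions Z d =
      φ '' (({(1, 1), (1, -1), (-1, 1), (-1, -1), (-2, 0)} : Finset (ℝ × ℝ)) : Set (ℝ × ℝ)) := by
    ext W
    constructor
    · intro hW
      obtain ⟨x, rfl⟩ := hsurj W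
      refine ⟨x, ?_, rfl⟩
      have := hW (φ (1, 1))
      rw [hobj, hobj, abs_sum_canonical_eq_one (x := (1, 1)) (by simp)] at this
      exact abs_sum_canonical hlpos (le_of_mul_le_mul_left this hK)
    · rintro ⟨x, hx, rfl⟩ V
      obtain ⟨y, rfl⟩ := hsurj V
      rw [hobj, hobj, abs_sum_canonical_eq_one hx]
      refine mul_le_mul_of_nonneg_left ?_ hK.le
      -- A value below 1 would put `y` among the five points, where the value is exactly 1.
      by_contra! hlt
      exact hlt.ne (abs_sum_canonical_eq_one (abs_sum_canonical hlpos hlt.le))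
  rw [hX, Set.ncard_image_of_injective _ hinj, Set.ncard_coe_finset]
  norm_num [Finset.card_insert_of_notMem]

theorem mainTheorem3 (Z : Fin 3 → EuclideanSpace ℝ (Fin 2)) (d : Fin 3 → ℝ)
    (hZ : Function.Injective Z) (hd : ∀ j, 0 ≤ d j) :
    (gpsSolutions Z d).ncard = 5 ↔
      ∃ σ : Equiv.Perm (Fin 3),
        FiveSolutionConditions (Z (σ 0)) (Z (σ 1)) (Z (σ 2)) (d (σ 0)) (d (σ 1)) (d (σ 2)) := by
  refine ⟨exists_conditions_of_ncard_eq_five hZ hd, ?_⟩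
  rintro ⟨σ, h⟩
  rw [← gpsSolutions_comp_perm Z d σ]
  exact ncard_eq_five_of_conditions
    ((hZ.comp σ.injective).ne (by decide : (0 : Fin 3) ≠ 1)) h
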